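/- Let $L$ be a frame, with implication $\to$, least element $0$ and greatest element $1$. An $L$-subset of a set $X$ is a map $X\to L$; for $A,B\in L^X$ put $\mathrm{sub}(A,B)=\bigwedge_{x\in X}A(x)\to B(x)$, and for $f:X\to Y$ put $f^{\rightarrow}(A)(y)=\bigvee_{f(x)=y}A(x)$. **$L$-orders.** An $L$-ordered set $(P,e)$ is a set with a map $e:P\times P\to L$ such that $e(x,x)=1$, $e(x,y)\wedge e(y,z)\le e(x,z)$, and $e(x,y)\wedge e(y,x)=1$ implies $x=y$. An element $x$ is the supremum $\sqcup A$ of $A\in L^P$ if $e(x,y)=\bigwedge_{z\in P}A(z)\to e(z,y)$ for all $y\in P$. An $L$-subset $D\in L^P$ is directed if $\bigvee_x D(x)=1$ and $D(x)\wedge D(y)\le\bigvee_z D(z)\wedge e(x,z)\wedge e(y,z)$ for all $x,y$; $P$ is an $L$-dcpo if every directed $L$-subset has a supremum. Let $\mathcal D^*_L(P)$ be the set of directed $L$-subsets of $P$ that have a supremum. Put $\Downarrow x(y)=\bigwedge_{D\in\mathcal D^*_L(P)}\big(e(x,\sqcup D)\to\bigvee_{d}D(d)\wedge e(y,d)\big)$.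 $P$ is continuous if for every $x\in P$ the $L$-subset $\Downarrow x$ is directed with supremum $x$; a continuous $L$-dcpo is a continuous $L$-ordered set that is an $L$-dcpo. A map $f:P\to Q$ is Scott continuous if for every $D\in\mathcal D^*_L(P)$ the supremum of $f^{\rightarrow}(D)$ exists and equals $f(\sqcup D)$. **$L$-topologies.** An $L$-topology on $X$ is a family $\mathcal O(X)\subseteq L^X$ (the open sets) closed under binary meets and arbitrary joins and containing all constant maps. A map $f:X\to Y$ is continuous if $B\circ f\in\mathcal O(X)$ for all $B\in\mathcal O(Y)$. A point of $\mathcal O(X)$ is a map $p:\mathcal O(X)\to L$ that preserves binary meets and arbitrary joins and sends each constant map to its value; $X$ is $L$-sober if $x\mapsto[x]$, $[x](A)=A(x)$, is a bijection from $X$ to the set of points. Every $L$-sober $X$ is $T_0$ (points that agree on all open sets are equal), and for $T_0$ $X$ the specialization $L$-order $e(x,y)=\bigwedge_{A\in\mathcal O(X)}A(x)\to A(y)$ makes $X$ an $L$-ordered set $\Omega_LX$. For an $L$-ordered set $P$, $\Sigma_LP$ is $P$ with the $L$-topology of Scott open sets, i.e. of those $A\in L^P$ with $A(x)\wedge e(x,y)\le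 A(y)$ for all $x,y$ and $A(\sqcup D)=\bigvee_xA(x)\wedge D(x)$ for every $D\in\mathcal D^*_L(P)$. **Universal constructions.** An $L$-sobrification of $X$ is an $L$-sober space $Y$ with a continuous map $j:X\to Y$ such that for every $L$-sober space $Z$ and continuous $f:X\to Z$ there is a unique continuous $\bar f:Y\to Z$ with $f=\bar f\circ j$. A directed completion of a continuous $L$-ordered set $P$ is a continuous $L$-dcpo $Q$ with a Scott continuous map $j:P\to Q$ such that for every continuous $L$-dcpo $M$ and Scott continuous $f:P\to M$ there is a unique Scott continuous $\bar f:Q\to M$ with $\bar f\circ j=f$. **Theorem.** Let $P$ and $Q$ be continuous $L$-ordered sets. 1. If $(Y,j)$ is an $L$-sobrification of $\Sigma_LP$, then $(\Omega_LY,j)$ is a directed completion of $P$. 2. For every map $j:P\to Q$, if $(Q,j)$ is a directed completion of $P$, then $(\Sigma_LQ,j)$ is an $L$-sobrification of $\Sigma_LP$. 3. For every map $j:P\to Q$, $(Q,j)$ is a directed completion of $P$ if and only if $(\Sigma_LQ,j)$ is an $L$-sobrification of $\Sigma_LP$. -/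

import Mathlib

universe u

/-! `L` is a frame throughout.  An `L`-subset of `X` is a map `X → L`; the pointwise order,
meets and joins of `L`-subsets are those of the function space. -/

section LSubsets

variable {L X Y : Type u} [Order.Frame L]

/-- The inclusion degree `sub(A, B) = ⋀ x, A x → B x` of `L`-subsets. -/
def inclDegree (A B : X → L) : L := ⨅ x, A x ⇨ B x

/-- The forward Zadeh extension `f^→(A)(y) = ⋁ {A x | f x = y}`. -/
def zadehImage (f : X → Y) (A : X → L) : Y → L := fun y => ⨆ x, ⨆ _ : f x = y, A x

end LSubsets

/-- An `L`-order on `P`. -/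
structure LOrder (L P : Type u) [Order.Frame L] where
  e : P → P → L
  refl : ∀ x, e x x = ⊤
  trans : ∀ x y z, e x y ⊓ e y z ≤ e x z
  antisymm : ∀ x y, e x y ⊓ e y x = ⊤ → x = y

/-- A (stratified) `L`-topology on `X`, given by its family of open `L`-subsets. -/
structure LTopology (L X : Type u) [Order.Frame L] where
  opens : Set (X → L)
  inf_mem : ∀ A ∈ opens, ∀ B ∈ opens, A ⊓ B ∈ opens
  sSup_mem : ∀ S ⊆ opens, sSup S ∈ opens
  const_mem : ∀ a : L, (fun _ => a) ∈ opens

namespace LOrder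

variable {L P Q : Type u} [Order.Frame L]

/-- The principal lower set `↓x`. -/
def lower (o : LOrder L P) (x : P) : P → L := fun y => o.e y x

/-- `x` is the supremum of the `L`-subset `A`: `e(x, y) = sub(A, ↓y)` for every `y`. -/
def IsSup (o : LOrder L P) (A : P → L) (x : P) : Prop :=
  ∀ y, o.e x y = inclDegree A (o.lower y)

/-- `A` is an upper set. -/
def IsUpper (o : LOrder L P) (A : P → L) : Prop :=
  ∀ x y, A x ⊓ o.e x y ≤ A y

/-- `D` is a directed `L`-subset (nonempty meaning that its join of values is `⊤`). -/
structure IsDirected (o : LOrder L P) (D : P → L) : Prop where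
  nonempty : ⨆ x, D x = ⊤
  directed : ∀ x y, D x ⊓ D y ≤ ⨆ z, D z ⊓ o.e x z ⊓ o.e y z

/-- `P` is an `L`-dcpo: every directed `L`-subset has a supremum. -/
def IsDcpo (o : LOrder L P) : Prop :=
  ∀ D : P → L, o.IsDirected D → ∃ x, o.IsSup D x

/-- The way-below `L`-subset of `x`, the meet being taken over all directed `L`-subsets `D` that
have a supremum `s`:  `⇓x(y) = ⋀_D e(x, ⊔D) → ⋁_d D(d) ∧ e(y, d)`. -/
def wayBelow (o : LOrder L P) (x : P) : P → L := fun y =>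
  ⨅ (D : P → L) (s : P) (_ : o.IsDirected D) (_ : o.IsSup D s),
    o.e x s ⇨ ⨆ d, D d ⊓ o.e y d

/-- `P` is a continuous `L`-ordered set: every `⇓x` is directed and has supremum `x`. -/
def IsContinuous (o : LOrder L P) : Prop :=
  ∀ x, o.IsDirected (o.wayBelow x) ∧ o.IsSup (o.wayBelow x) x

/-- `f` is Scott continuous: for every directed `D` that has a supremum `x`, the `L`-subset
`f^→(D)` has a supremum, namely `f x`. -/
def ScottContinuous (o : LOrder L P) (o' : LOrder L Q) (f : P → Q) : Prop :=
  ∀ (D : P → L) (x : P), o.IsDirected D → o.IsSup D x → o'.IsSup (zadehImage f D) (f x)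

/-- `A` is Scott open: an upper set with `A(⊔D) = ⋁ y, A y ∧ D y` for every directed `D` that
has a supremum. -/
structure IsScottOpen (o : LOrder L P) (A : P → L) : Prop where
  upper : o.IsUpper A
  sup_eq : ∀ (D : P → L) (x : P), o.IsDirected D → o.IsSup D x → A x = ⨆ y, A y ⊓ D y

/-- The Scott `L`-topology; `P` with this topology is the space `Σ_L P`. -/
def scott (o : LOrder L P) : LTopology L P where
  opens := {A | o.IsScottOpen A}
  inf_mem := by
    intro A hA B hB
    replace hA : o.IsScottOpen A := hA
    replace hB : o.IsScottOpen B := hB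
    refine ⟨fun x y => ?_, fun D s hD hs => le_antisymm ?_ ?_⟩
    · exact le_inf ((inf_le_inf_right _ inf_le_left).trans (hA.upper x y))
        ((inf_le_inf_right _ inf_le_right).trans (hB.upper x y))
    · rw [Pi.inf_apply, hA.sup_eq D s hD hs, hB.sup_eq D s hD hs, iSup_inf_iSup]
      refine iSup_le fun ⟨x, y⟩ => ?_
      have h1 : A x ⊓ D x ⊓ (B y ⊓ D y) ≤ A x ⊓ B y ⊓ ⨆ z, D z ⊓ o.e x z ⊓ o.e y z :=
        le_inf (inf_le_inf inf_le_left inf_le_left)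
          ((inf_le_inf inf_le_right inf_le_right).trans (hD.directed x y))
      refine h1.trans ?_
      rw [inf_iSup_eq]
      refine iSup_mono fun z => ?_
      refine le_inf (le_inf ?_ ?_) ?_
      · refine le_trans ?_ (hA.upper x z)
        exact inf_le_inf inf_le_left (inf_le_left.trans inf_le_right)
      · refine le_trans ?_ (hB.upper y z)
        exact inf_le_inf inf_le_right inf_le_right
      · exact inf_le_right.trans (inf_le_left.trans inf_le_left)
    · refine iSup_le fun y => le_inf ?_ ?_
      · rw [hA.sup_eq D s hD hs]
        exact (inf_le_inf_right _ inf_le_left).trans (le_iSup (fun y => A y ⊓ D y) y)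
      · rw [hB.sup_eq D s hD hs]
        exact (inf_le_inf_right _ inf_le_right).trans (le_iSup (fun y => B y ⊓ D y) y)
  sSup_mem := by
    intro S hS
    replace hS : ∀ A ∈ S, o.IsScottOpen A := hS
    refine ⟨fun x y => ?_, fun D s hD hs => ?_⟩
    · rw [sSup_apply, sSup_apply, iSup_inf_eq]
      exact iSup_mono fun A => (hS A.1 A.2).upper x y
    · simp only [sSup_apply, iSup_inf_eq]
      rw [iSup_comm]
      exact iSup_congr fun A => (hS A.1 A.2).sup_eq D s hD hs
  const_mem := by
    intro a
    refine ⟨fun x y => inf_le_left, fun D s hD _ => ?_⟩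
    rw [← inf_iSup_eq, hD.nonempty, inf_top_eq]

end LOrder

namespace LTopology

variable {L X Y : Type u} [Order.Frame L]

/-- `f` is continuous: preimages `B ∘ f` of open `L`-subsets are open. -/
def Continuous (τ : LTopology L X) (τ' : LTopology L Y) (f : X → Y) : Prop :=
  ∀ B ∈ τ'.opens, B ∘ f ∈ τ.opens

/-- The `T₀` axiom. -/
def IsT0 (τ : LTopology L X) : Prop :=
  ∀ x y, (∀ A ∈ τ.opens, A x = A y) → x = y

/-- The specialization `L`-order `e(x, y) = ⋀_A A x → A y` of a `T₀` space `X`; `X` with this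
order is `Ω_L X`. -/
def specialization (τ : LTopology L X) (h : τ.IsT0) : LOrder L X where
  e x y := ⨅ A ∈ τ.opens, A x ⇨ A y
  refl x := by simp
  trans x y z := by
    refine le_iInf₂ fun A hA => ?_
    exact (inf_le_inf (iInf₂_le A hA) (iInf₂_le A hA)).trans (himp_triangle _ _ _)
  antisymm x y hxy := by
    obtain ⟨h1, h2⟩ := inf_eq_top_iff.1 hxy
    simp only [iInf_eq_top, himp_eq_top_iff] at h1 h2
    exact h x y fun A hA => le_antisymm (h1 A hA) (h2 A hA)

/-- A point of `O(X)`: a map `O(X) → L` preserving binary meets, arbitrary joins and constants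
(that is, an `L`-frame homomorphism from `O(X)` to `L`). -/
@[ext]
structure Point (τ : LTopology L X) where
  toFun : τ.opens → L
  map_inf : ∀ A B : τ.opens, toFun ⟨A.1 ⊓ B.1, τ.inf_mem A.1 A.2 B.1 B.2⟩ = toFun A ⊓ toFun B
  map_sSup : ∀ S : Set τ.opens,
    toFun ⟨sSup (Subtype.val '' S), τ.sSup_mem _ (Subtype.coe_image_subset _ S)⟩ =
      ⨆ A ∈ S, toFun A
  map_const : ∀ a : L, toFun ⟨fun _ => a, τ.const_mem a⟩ = a

/-- The map `η_X : X → pt_L O(X)`, `x ↦ [x]` with `[x](A) = A x`. -/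
def eta (τ : LTopology L X) (x : X) : τ.Point where
  toFun A := A.1 x
  map_inf _ _ := rfl
  map_sSup S := by
    change sSup (Subtype.val '' S) x = ⨆ A ∈ S, A.1 x
    simp only [sSup_image, iSup_apply]
  map_const _ := rfl

/-- `X` is `L`-sober: `η_X` is a bijection. -/
def IsLSober (τ : LTopology L X) : Prop := Function.Bijective τ.eta

theorem IsLSober.isT0 {τ : LTopology L X} (h : τ.IsLSober) : τ.IsT0 := by
  intro x y hxy
  refine h.1 (Point.ext ?_)
  funext A
  exact hxy A.1 A.2

end LTopology

/-- `(Y, j)` is an `L`-sobrification of `X`. -/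
structure IsLSobrification {L X Y : Type u} [Order.Frame L]
    (τX : LTopology L X) (τY : LTopology L Y) (j : X → Y) : Prop where
  sober : τY.IsLSober
  continuous : τX.Continuous τY j
  universal : ∀ (Z : Type u) (τZ : LTopology L Z), τZ.IsLSober →
    ∀ f : X → Z, τX.Continuous τZ f → ∃! g : Y → Z, τY.Continuous τZ g ∧ f = g ∘ j

/-- `(Q, j)` is a directed completion of the continuous `L`-ordered set `P`. -/
structure IsDirectedCompletion {L P Q : Type u} [Order.Frame L]
    (oP : LOrder L P) (oQ : LOrder L Q) (j : P → Q) : Prop where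
  isContinuous : oQ.IsContinuous
  isDcpo : oQ.IsDcpo
  scottContinuous : oP.ScottContinuous oQ j
  universal : ∀ (M : Type u) (oM : LOrder L M), oM.IsContinuous → oM.IsDcpo →
    ∀ f : P → M, oP.ScottContinuous oM f → ∃! g : Q → M, oQ.ScottContinuous oM g ∧ g ∘ j = f

/-! The bridge between the two universal properties is the notion of a core base: open sets `U i`
indexed by points `b i` with `A = ⋁ i, A (b i) ∧ U i` for every open `A`. Interpolation makes
`x ↦ ⇓x(z)` a core base of `Σ_L P` for continuous `P`. Over a core base points of the topology are
the same as directed `L`-subsets, so that `Σ_L P` is `L`-sober once the continuous `P` is an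
`L`-dcpo; conversely an `L`-sober space `Y` with a core base carries the Scott topology of the
continuous `L`-dcpo `Ω_L Y`. Since Scott continuity into a continuous `L`-ordered set is continuity
for the Scott topologies, continuous `L`-dcpos are thus the `L`-sober spaces with a core base.

The `L`-sobrifications of `X` are the maps into an `L`-sober space under which the open sets of
both spaces correspond bijectively, and these maps transport core bases. Hence the
`L`-sobrification of `Σ_L P` never leaves the realm of continuous `L`-dcpos, and it has there the
universal property of the directed completion. -/

section LSubsets

variable {L X Y : Type u} [Order.Frame L]

theorem le_inclDegree_iff {A B : X → L} {a : L} :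
    a ≤ inclDegree A B ↔ ∀ x, a ⊓ A x ≤ B x := by
  simp only [inclDegree, le_iInf_iff, le_himp_iff]

theorem le_zadehImage (f : X → Y) (A : X → L) (x : X) : A x ≤ zadehImage f A (f x) :=
  le_iSup₂_of_le x rfl le_rfl

theorem zadehImage_le_iff {f : X → Y} {A : X → L} {B : Y → L} :
    zadehImage f A ≤ B ↔ A ≤ B ∘ f := by
  refine ⟨fun h x => (le_zadehImage f A x).trans (h (f x)), fun h _ => iSup₂_le ?_⟩
  rintro x rfl
  exact h x

theorem iSup_inf_zadehImage (f : X → Y) (A : X → L) (B : Y → L) :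
    ⨆ y, B y ⊓ zadehImage f A y = ⨆ x, B (f x) ⊓ A x := by
  simp only [zadehImage, inf_iSup_eq]
  rw [iSup_comm]
  simp only [iSup_iSup_eq_right]

theorem iSup_zadehImage (f : X → Y) (A : X → L) : ⨆ y, zadehImage f A y = ⨆ x, A x := by
  simpa only [top_inf_eq] using iSup_inf_zadehImage f A fun _ => ⊤

end LSubsets

attribute [ext] LOrder LTopology

namespace LOrder

section Suprema

variable {L P : Type u} [Order.Frame L] {o : LOrder L P} {A B D E : P → L} {s t : P}

theorem isUpper_e (o : LOrder L P) (x : P) : o.IsUpper (o.e x) := o.trans x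

theorem isSup_iff_forall_le :
    o.IsSup D s ↔ ∀ a y, a ≤ o.e s y ↔ ∀ z, a ⊓ D z ≤ o.e z y := by
  refine ⟨fun h a y => ?_, fun h y => eq_of_forall_le_iff fun a => ?_⟩
  · rw [h y, le_inclDegree_iff]
    rfl
  · rw [h a y, le_inclDegree_iff]
    rfl

theorem IsSup.le_e_iff (h : o.IsSup D s) {a : L} {y : P} :
    a ≤ o.e s y ↔ ∀ z, a ⊓ D z ≤ o.e z y :=
  isSup_iff_forall_le.1 h a y

theorem IsSup.le_e (h : o.IsSup D s) (z : P) : D z ≤ o.e z s := by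
  simpa only [top_inf_eq] using h.le_e_iff.1 (o.refl s).ge z

theorem IsSup.unique (hs : o.IsSup D s) (ht : o.IsSup D t) : s = t := by
  refine o.antisymm s t (inf_eq_top_iff.2 ⟨?_, ?_⟩)
  · rw [hs t, ← ht t, o.refl]
  · rw [ht s, ← hs s, o.refl]

theorem isSup_lower (o : LOrder L P) (x : P) : o.IsSup (o.lower x) x := by
  refine isSup_iff_forall_le.2 fun a y => ⟨fun h z => ?_, fun h => ?_⟩
  · rw [inf_comm]
    exact (inf_le_inf_left _ h).trans (o.trans z x y)
  · simpa only [lower, o.refl, inf_top_eq] using h x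

theorem isDirected_lower (o : LOrder L P) (x : P) : o.IsDirected (o.lower x) where
  nonempty := top_le_iff.1 <| (o.refl x).ge.trans (le_iSup (o.lower x) x)
  directed y z := le_iSup_of_le x <| by simp only [lower, o.refl, top_inf_eq, le_refl]

theorem IsSup.cofinal (hs : o.IsSup D s) (hle : D ≤ E) (hcof : ∀ x, E x ≤ ⨆ d, D d ⊓ o.e x d) :
    o.IsSup E s := by
  refine isSup_iff_forall_le.2 fun a y =>
    ⟨fun h z => ?_, fun h => hs.le_e_iff.2 fun z => (inf_le_inf_left _ (hle z)).trans (h z)⟩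
  have hEs : E z ≤ o.e z s := (hcof z).trans <| iSup_le fun d => by
    rw [inf_comm]
    exact (inf_le_inf_left _ (hs.le_e d)).trans (o.trans z d s)
  rw [inf_comm]
  exact (inf_le_inf hEs h).trans (o.trans z s y)

theorem IsSup.iSup_inf {F : P → P → L} (hD : o.IsSup D s) (hF : ∀ z, o.IsSup (F z) z) :
    o.IsSup (fun y => ⨆ z, F z y ⊓ D z) s := by
  refine isSup_iff_forall_le.2 fun a y => ?_
  calc a ≤ o.e s y ↔ ∀ z, a ⊓ D z ≤ o.e z y := hD.le_e_iff
    _ ↔ ∀ z w, a ⊓ D z ⊓ F z w ≤ o.e w y := forall_congr' fun z => (hF z).le_e_iff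
    _ ↔ ∀ w, a ⊓ ⨆ z, F z w ⊓ D z ≤ o.e w y := by
      simp only [inf_iSup_eq, iSup_le_iff, inf_assoc, inf_comm (D _)]
      exact forall_comm

theorem IsDirected.iSup_inf_inf_iSup_inf (hD : o.IsDirected D) (hA : o.IsUpper A)
    (hB : o.IsUpper B) :
    (⨆ x, A x ⊓ D x) ⊓ (⨆ x, B x ⊓ D x) = ⨆ x, A x ⊓ B x ⊓ D x := by
  refine le_antisymm ?_ (le_inf ?_ ?_)
  · rw [iSup_inf_iSup]
    refine iSup_le fun ⟨x, y⟩ => ?_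
    calc A x ⊓ D x ⊓ (B y ⊓ D y) = A x ⊓ B y ⊓ (D x ⊓ D y) := inf_inf_inf_comm ..
      _ ≤ A x ⊓ B y ⊓ ⨆ z, D z ⊓ o.e x z ⊓ o.e y z := inf_le_inf_left _ (hD.directed x y)
      _ = ⨆ z, (A x ⊓ o.e x z) ⊓ (B y ⊓ o.e y z) ⊓ D z := by
        rw [inf_iSup_eq]
        exact iSup_congr fun z => by ac_rfl
      _ ≤ ⨆ z, A z ⊓ B z ⊓ D z :=
        iSup_mono fun z => inf_le_inf_right _ (inf_le_inf (hA x z) (hB y z))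
  · exact iSup_mono fun x => inf_le_inf_right _ inf_le_left
  · exact iSup_mono fun x => inf_le_inf_right _ inf_le_right

theorem IsDirected.cofinal (hD : o.IsDirected D) (hle : D ≤ E)
    (hcof : ∀ x, E x ≤ ⨆ d, D d ⊓ o.e x d) : o.IsDirected E where
  nonempty := top_le_iff.1 <| hD.nonempty.ge.trans (iSup_mono hle)
  directed x y :=
    calc E x ⊓ E y ≤ (⨆ d, o.e x d ⊓ D d) ⊓ (⨆ d, o.e y d ⊓ D d) := by
          simpa only [inf_comm] using inf_le_inf (hcof x) (hcof y)
      _ = ⨆ d, o.e x d ⊓ o.e y d ⊓ D d :=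
        hD.iSup_inf_inf_iSup_inf (o.isUpper_e x) (o.isUpper_e y)
      _ ≤ ⨆ d, E d ⊓ o.e x d ⊓ o.e y d := iSup_mono fun d => by
        rw [inf_comm, inf_assoc]
        exact inf_le_inf_right _ (hle d)

theorem IsDirected.iSup_inf {F : P → P → L} (hD : o.IsDirected D) (hF : ∀ z, o.IsDirected (F z))
    (hup : ∀ y, o.IsUpper fun z => F z y) : o.IsDirected fun y => ⨆ z, F z y ⊓ D z where
  nonempty := by
    rw [iSup_comm]
    simp only [← iSup_inf_eq, (hF _).nonempty, top_inf_eq, hD.nonempty]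
  directed x y :=
    calc (⨆ z, F z x ⊓ D z) ⊓ (⨆ z, F z y ⊓ D z) = ⨆ z, F z x ⊓ F z y ⊓ D z :=
          hD.iSup_inf_inf_iSup_inf (hup x) (hup y)
      _ ≤ ⨆ z, (⨆ w, F z w ⊓ o.e x w ⊓ o.e y w) ⊓ D z :=
        iSup_mono fun z => inf_le_inf_right _ ((hF z).directed x y)
      _ = ⨆ w, (⨆ z, F z w ⊓ D z) ⊓ o.e x w ⊓ o.e y w := by
        simp only [iSup_inf_eq]
        rw [iSup_comm]
        exact iSup_congr fun w => iSup_congr fun z => by ac_rfl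

theorem isDirected_zadehImage {X : Type u} {f : X → P} {C : X → L} (hne : ⨆ x, C x = ⊤)
    (hdir : ∀ x y, C x ⊓ C y ≤ ⨆ z, C z ⊓ o.e (f x) (f z) ⊓ o.e (f y) (f z)) :
    o.IsDirected (zadehImage f C) where
  nonempty := (iSup_zadehImage f C).trans hne
  directed p q := by
    have hdir' : ∀ x y,
        C x ⊓ C y ≤ ⨆ r, zadehImage f C r ⊓ o.e (f x) r ⊓ o.e (f y) r := fun x y =>
      (hdir x y).trans <| iSup_le fun z => le_iSup_of_le (f z) <|
        inf_le_inf_right _ (inf_le_inf_right _ (le_zadehImage f C z))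
    conv_lhs => simp only [zadehImage, iSup_inf_eq, inf_iSup_eq]
    simp only [iSup_le_iff]
    rintro y rfl x rfl
    exact hdir' x y

end Suprema

section WayBelow

variable {L P : Type u} [Order.Frame L] {o : LOrder L P} {D : P → L} {s : P}

theorem le_wayBelow_iff {a : L} {x y : P} :
    a ≤ o.wayBelow x y ↔ ∀ (D : P → L) (s : P), o.IsDirected D → o.IsSup D s →
      a ⊓ o.e x s ≤ ⨆ d, D d ⊓ o.e y d := by
  simp only [wayBelow, le_iInf_iff, le_himp_iff]

theorem IsDirected.wayBelow_inf_e_le (hD : o.IsDirected D) (hs : o.IsSup D s) (x y : P) :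
    o.wayBelow x y ⊓ o.e x s ≤ ⨆ d, D d ⊓ o.e y d :=
  le_wayBelow_iff.1 le_rfl D s hD hs

theorem IsDirected.wayBelow_le (hD : o.IsDirected D) (hs : o.IsSup D s) (y : P) :
    o.wayBelow s y ≤ ⨆ d, D d ⊓ o.e y d := by
  simpa only [o.refl, inf_top_eq] using hD.wayBelow_inf_e_le hs s y

theorem wayBelow_le_e (o : LOrder L P) (x y : P) : o.wayBelow x y ≤ o.e y x := by
  refine ((o.isDirected_lower x).wayBelow_le (o.isSup_lower x) y).trans (iSup_le fun d => ?_)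
  rw [inf_comm]
  exact o.trans y d x

theorem isUpper_wayBelow (o : LOrder L P) (y : P) : o.IsUpper fun x => o.wayBelow x y := by
  refine fun x x' => le_wayBelow_iff.2 fun D s hD hs => ?_
  rw [inf_assoc]
  exact (inf_le_inf_left _ (o.trans x x' s)).trans (hD.wayBelow_inf_e_le hs x y)

theorem wayBelow_inf_e_le (o : LOrder L P) (x y y' : P) :
    o.wayBelow x y ⊓ o.e y' y ≤ o.wayBelow x y' := by
  refine le_wayBelow_iff.2 fun D s hD hs => ?_
  calc o.wayBelow x y ⊓ o.e y' y ⊓ o.e x s = o.e y' y ⊓ (o.wayBelow x y ⊓ o.e x s) := by ac_rfl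
    _ ≤ o.e y' y ⊓ ⨆ d, D d ⊓ o.e y d := inf_le_inf_left _ (hD.wayBelow_inf_e_le hs x y)
    _ = ⨆ d, D d ⊓ (o.e y' y ⊓ o.e y d) := by
      rw [inf_iSup_eq]
      exact iSup_congr fun d => inf_left_comm ..
    _ ≤ ⨆ d, D d ⊓ o.e y' d := iSup_mono fun d => inf_le_inf_left _ (o.trans y' y d)

theorem isContinuous_of_le_wayBelow
    (h : ∀ x, ∃ D : P → L, o.IsDirected D ∧ o.IsSup D x ∧ D ≤ o.wayBelow x) :
    o.IsContinuous := fun x =>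
  let ⟨_, hD, hs, hle⟩ := h x
  ⟨hD.cofinal hle (hD.wayBelow_le hs), hs.cofinal hle (hD.wayBelow_le hs)⟩

theorem IsContinuous.wayBelow_interpolation (h : o.IsContinuous) (x y : P) :
    o.wayBelow x y ≤ ⨆ z, o.wayBelow z y ⊓ o.wayBelow x z := by
  have hdir : o.IsDirected fun w => ⨆ z, o.wayBelow z w ⊓ o.wayBelow x z :=
    (h x).1.iSup_inf (fun z => (h z).1) o.isUpper_wayBelow
  have hsup : o.IsSup (fun w => ⨆ z, o.wayBelow z w ⊓ o.wayBelow x z) x :=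
    (h x).2.iSup_inf fun z => (h z).2
  refine (hdir.wayBelow_le hsup y).trans (iSup_le fun w => ?_)
  rw [iSup_inf_eq]
  refine iSup_mono fun z => ?_
  rw [inf_right_comm]
  exact inf_le_inf_right _ (o.wayBelow_inf_e_le z w y)

theorem IsContinuous.isScottOpen_wayBelow (h : o.IsContinuous) (y : P) :
    o.IsScottOpen fun x => o.wayBelow x y where
  upper := o.isUpper_wayBelow y
  sup_eq D s hD hs := by
    refine le_antisymm ?_ (iSup_le fun d =>
      (inf_le_inf_left _ (hs.le_e d)).trans (o.isUpper_wayBelow y d s))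
    calc o.wayBelow s y ≤ ⨆ z, o.wayBelow z y ⊓ o.wayBelow s z := h.wayBelow_interpolation s y
      _ ≤ ⨆ z, o.wayBelow z y ⊓ ⨆ d, D d ⊓ o.e z d :=
        iSup_mono fun z => inf_le_inf_left _ (hD.wayBelow_le hs z)
      _ = ⨆ z, ⨆ d, o.wayBelow z y ⊓ o.e z d ⊓ D d := by
        simp only [inf_iSup_eq, inf_assoc, inf_comm (D _)]
      _ ≤ ⨆ d, o.wayBelow d y ⊓ D d := iSup_le fun z =>
        iSup_mono fun d => inf_le_inf_right _ (o.isUpper_wayBelow y z d)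

theorem IsContinuous.iInf_scottOpen_himp (h : o.IsContinuous) (x y : P) :
    ⨅ A ∈ o.scott.opens, A x ⇨ A y = o.e x y := by
  refine le_antisymm ((h x).2.le_e_iff.2 fun z => ?_) (le_iInf₂ fun A hA => le_himp_iff.2 ?_)
  · exact (le_himp_iff.1 (iInf₂_le _ (h.isScottOpen_wayBelow z))).trans (o.wayBelow_le_e y z)
  · rw [inf_comm]
    exact IsScottOpen.upper hA x y

theorem IsContinuous.isT0_scott (h : o.IsContinuous) : o.scott.IsT0 := by
  refine fun x y hxy => o.antisymm x y ?_
  simp +contextual only [← h.iInf_scottOpen_himp, hxy, himp_self, iInf_top, inf_top_eq]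

theorem IsContinuous.specialization_scott (h : o.IsContinuous) (h0 : o.scott.IsT0) :
    o.scott.specialization h0 = o :=
  LOrder.ext <| funext₂ h.iInf_scottOpen_himp

end WayBelow

end LOrder

namespace LTopology

variable {L X Y Z : Type u} [Order.Frame L] {τ : LTopology L X} {τY : LTopology L Y}
  {τZ : LTopology L Z}

theorem iSup_mem (τ : LTopology L X) {ι : Sort*} {A : ι → X → L} (h : ∀ i, A i ∈ τ.opens) :
    ⨆ i, A i ∈ τ.opens :=
  τ.sSup_mem _ (Set.range_subset_iff.2 h)

theorem iSup_const_inf_mem (τ : LTopology L X) {ι : Sort*} (a : ι → L) {A : ι → X → L}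
    (h : ∀ i, A i ∈ τ.opens) : (fun x => ⨆ i, a i ⊓ A i x) ∈ τ.opens := by
  have : (fun x => ⨆ i, a i ⊓ A i x) = ⨆ i, (fun _ => a i) ⊓ A i := by
    ext x
    simp only [iSup_apply, Pi.inf_apply]
  rw [this]
  exact τ.iSup_mem fun i => τ.inf_mem _ (τ.const_mem (a i)) _ (h i)

theorem continuous_id (τ : LTopology L X) : τ.Continuous τ id := fun _ hA => hA

theorem Continuous.comp {f : X → Y} {g : Y → Z} (hg : τY.Continuous τZ g)
    (hf : τ.Continuous τY f) : τ.Continuous τZ (g ∘ f) :=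
  fun B hB => hf _ (hg B hB)

theorem IsT0.eta_injective (h : τ.IsT0) : Function.Injective τ.eta := fun x y hxy =>
  h x y fun A hA => congrFun (congrArg Point.toFun hxy) ⟨A, hA⟩

section Limits

variable {D : X → L} {s : X}

/-- Convergence of an `L`-subset `D` to `s`: every open `L`-subset contains `s` to the degree to
which it meets `D`. It is the topological counterpart of being a supremum of a directed `D`. -/
def IsLimit (τ : LTopology L X) (D : X → L) (s : X) : Prop :=
  ∀ A ∈ τ.opens, A s = ⨆ x, A x ⊓ D x

theorem Continuous.isLimit_zadehImage {f : X → Y} (hf : τ.Continuous τY f)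
    (h : τ.IsLimit D s) : τY.IsLimit (zadehImage f D) (f s) := fun B hB =>
  (h _ (hf B hB)).trans (iSup_inf_zadehImage f D B).symm

theorem le_specialization_e_iff (h : τ.IsT0) {a : L} {x y : X} :
    a ≤ (τ.specialization h).e x y ↔ ∀ A ∈ τ.opens, a ⊓ A x ≤ A y := by
  simp only [specialization, le_iInf_iff, le_himp_iff]

theorem isUpper_of_mem_opens (h : τ.IsT0) {A : X → L} (hA : A ∈ τ.opens) :
    (τ.specialization h).IsUpper A := fun x y => by
  rw [inf_comm]
  exact (le_specialization_e_iff h).1 le_rfl A hA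

theorem IsLimit.isSup (hs : τ.IsLimit D s) (h : τ.IsT0) :
    (τ.specialization h).IsSup D s := by
  refine LOrder.isSup_iff_forall_le.2 fun a y => ?_
  calc a ≤ (τ.specialization h).e s y ↔ ∀ A ∈ τ.opens, ∀ x, a ⊓ D x ⊓ A x ≤ A y := by
        rw [le_specialization_e_iff]
        refine forall₂_congr fun A hA => ?_
        simp only [hs A hA, inf_iSup_eq, iSup_le_iff, inf_assoc, inf_comm (D _)]
    _ ↔ ∀ x, a ⊓ D x ≤ (τ.specialization h).e x y := by
        simp only [le_specialization_e_iff]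
        exact ⟨fun H x A hA => H A hA x, fun H A hA x => H x A hA⟩

/-- The point of `O(X)` given by a directed `L`-subset `D` of `Ω_L X`, which sends an open
`L`-subset to the degree to which it meets `D`. -/
def directedPoint (h : τ.IsT0) (hD : (τ.specialization h).IsDirected D) : τ.Point where
  toFun A := ⨆ x, A.1 x ⊓ D x
  map_inf A B := (hD.iSup_inf_inf_iSup_inf (isUpper_of_mem_opens h A.2)
    (isUpper_of_mem_opens h B.2)).symm
  map_sSup S := by
    simp only [sSup_image, iSup_apply, iSup_inf_eq]
    rw [iSup_comm]
    exact iSup_congr fun A => iSup_comm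
  map_const a := by rw [← inf_iSup_eq, hD.nonempty, inf_top_eq]

theorem IsLSober.exists_isLimit (h : τ.IsLSober)
    (hD : (τ.specialization h.isT0).IsDirected D) : ∃ s, τ.IsLimit D s :=
  let ⟨s, hs⟩ := h.2 (directedPoint h.isT0 hD)
  ⟨s, fun A hA => congrFun (congrArg Point.toFun hs) ⟨A, hA⟩⟩

theorem IsLSober.isDcpo (h : τ.IsLSober) : (τ.specialization h.isT0).IsDcpo := fun _ hD =>
  let ⟨s, hs⟩ := h.exists_isLimit hD
  ⟨s, hs.isSup h.isT0⟩

theorem IsLSober.isScottOpen (h : τ.IsLSober) {A : X → L} (hA : A ∈ τ.opens) :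
    (τ.specialization h.isT0).IsScottOpen A where
  upper := isUpper_of_mem_opens h.isT0 hA
  sup_eq D s hD hs := by
    obtain ⟨t, ht⟩ := h.exists_isLimit hD
    rw [hs.unique (ht.isSup h.isT0), ht A hA]

end Limits

section Points

theorem Point.map_iSup (p : τ.Point) {ι : Sort*} (B : ι → τ.opens) :
    p.toFun ⟨⨆ i, (B i).1, τ.iSup_mem fun i => (B i).2⟩ = ⨆ i, p.toFun (B i) := by
  rw [← iSup_range (g := p.toFun), ← p.map_sSup]
  congr 2
  rw [← Set.range_comp]
  rfl

theorem Point.map_iSup_const_inf (p : τ.Point) {ι : Sort*} (a : ι → L) (B : ι → τ.opens) :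
    p.toFun ⟨fun x => ⨆ i, a i ⊓ (B i).1 x, τ.iSup_const_inf_mem a fun i => (B i).2⟩ =
      ⨆ i, a i ⊓ p.toFun (B i) := by
  let C (i : ι) : τ.opens := ⟨(fun _ => a i) ⊓ (B i).1, τ.inf_mem _ (τ.const_mem _) _ (B i).2⟩
  have hC : ∀ i, p.toFun (C i) = a i ⊓ p.toFun (B i) := fun i =>
    (p.map_inf ⟨_, τ.const_mem (a i)⟩ (B i)).trans (by rw [p.map_const])
  simp only [← hC, ← p.map_iSup]
  congr 2
  ext x
  simp only [C, iSup_apply, Pi.inf_apply]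

/-- The image of a point under a continuous map `f`, namely its composition with `B ↦ B ∘ f`. -/
def Point.map {f : X → Y} (hf : τ.Continuous τY f) (p : τ.Point) : τY.Point where
  toFun B := p.toFun ⟨B.1 ∘ f, hf B.1 B.2⟩
  map_inf A B := p.map_inf ⟨A.1 ∘ f, hf A.1 A.2⟩ ⟨B.1 ∘ f, hf B.1 B.2⟩
  map_sSup S := by
    rw [iSup_subtype', ← p.map_iSup]
    congr 2
    ext x
    simp only [Function.comp_apply, sSup_image, iSup_apply, iSup_subtype']
  map_const a := p.map_const a

/-- The space `pt_L O(X)` of points of `O(X)`, with the open `L`-subsets `p ↦ p A`. With `η_X` it is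
the standard `L`-sobrification of `X`. -/
def spectrum (τ : LTopology L X) : LTopology L τ.Point where
  opens := Set.range fun (A : τ.opens) (p : τ.Point) => p.toFun A
  inf_mem := by
    rintro _ ⟨A, rfl⟩ _ ⟨B, rfl⟩
    exact ⟨⟨A.1 ⊓ B.1, τ.inf_mem A.1 A.2 B.1 B.2⟩, funext fun p => p.map_inf A B⟩
  sSup_mem := by
    intro S hS
    obtain ⟨T, rfl⟩ := Set.subset_range_iff_exists_image_eq.1 hS
    refine ⟨⟨sSup (Subtype.val '' T), τ.sSup_mem _ (Subtype.coe_image_subset _ T)⟩,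
      funext fun p => (p.map_sSup T).trans ?_⟩
    simp only [sSup_image, iSup_apply]
  const_mem a := ⟨⟨_, τ.const_mem a⟩, funext fun p => p.map_const a⟩

/-- The point of `O(X)` underlying a point of the topology of `spectrum`. -/
def Point.ofSpectrum (p : τ.spectrum.Point) : τ.Point where
  toFun A := p.toFun ⟨_, A, rfl⟩
  map_inf A B := by
    rw [← p.map_inf]
    congr 2
    exact funext fun q => q.map_inf A B
  map_sSup S := by
    rw [iSup_subtype', ← p.map_iSup]
    congr 2
    ext q
    refine (q.map_sSup S).trans ?_
    rw [iSup_subtype', iSup_apply]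
  map_const a := by
    refine Eq.trans ?_ (p.map_const a)
    congr 2
    exact funext fun q => q.map_const a

theorem isLSober_spectrum (τ : LTopology L X) : τ.spectrum.IsLSober := by
  refine ⟨fun p q h => Point.ext (funext fun A => ?_), fun p => ⟨p.ofSpectrum, ?_⟩⟩
  · exact congrFun (congrArg Point.toFun h) ⟨_, A, rfl⟩
  · refine Point.ext (funext ?_)
    rintro ⟨_, A, rfl⟩
    rfl

end Points

section QuasiHomeomorphisms

variable {j : X → Y}

/-- A quasi-homeomorphism: a map `j` for which `B ↦ B ∘ j` is a bijection from the open `L`-subsets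
of `Y` to those of `X`. -/
structure IsQuasiHomeomorph (τ : LTopology L X) (τY : LTopology L Y) (j : X → Y) : Prop where
  continuous : τ.Continuous τY j
  ext : ∀ A ∈ τY.opens, ∀ B ∈ τY.opens, A ∘ j = B ∘ j → A = B
  exists_extension : ∀ A ∈ τ.opens, ∃ B ∈ τY.opens, B ∘ j = A

theorem isQuasiHomeomorph_eta (τ : LTopology L X) : τ.IsQuasiHomeomorph τ.spectrum τ.eta where
  continuous := by
    rintro _ ⟨A, rfl⟩
    exact A.2
  ext := by
    rintro _ ⟨A, rfl⟩ _ ⟨B, rfl⟩ h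
    obtain rfl : A = B := Subtype.ext h
    rfl
  exists_extension A hA := ⟨_, ⟨⟨A, hA⟩, rfl⟩, rfl⟩

namespace IsQuasiHomeomorph

theorem map_ext (hj : τ.IsQuasiHomeomorph τY j) (hZ : τZ.IsT0) {g g' : Y → Z}
    (hg : τY.Continuous τZ g) (hg' : τY.Continuous τZ g') (h : g ∘ j = g' ∘ j) : g = g' :=
  funext fun y => hZ _ _ fun B hB => congrFun (hj.ext _ (hg B hB) _ (hg' B hB)
    (congrArg (B ∘ ·) h)) y

/-- The inverse of the bijection `B ↦ B ∘ j` on open `L`-subsets. -/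
noncomputable def extend (hj : τ.IsQuasiHomeomorph τY j) (A : τ.opens) : τY.opens :=
  ⟨_, (hj.exists_extension A.1 A.2).choose_spec.1⟩

theorem extend_comp (hj : τ.IsQuasiHomeomorph τY j) (A : τ.opens) :
    (hj.extend A).1 ∘ j = A.1 :=
  (hj.exists_extension A.1 A.2).choose_spec.2

theorem extend_eq (hj : τ.IsQuasiHomeomorph τY j) {A : τ.opens} {B : Y → L}
    (hB : B ∈ τY.opens) (h : B ∘ j = A.1) :
    (hj.extend A).1 = B :=
  hj.ext _ (hj.extend A).2 _ hB ((hj.extend_comp A).trans h.symm)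

/-- The point of `O(X)` corresponding to a point `y` of the codomain `Y` of `j`. -/
noncomputable def point (hj : τ.IsQuasiHomeomorph τY j) (y : Y) : τ.Point where
  toFun A := (hj.extend A).1 y
  map_inf A B := by
    rw [hj.extend_eq (τY.inf_mem _ (hj.extend A).2 _ (hj.extend B).2)]
    · rfl
    · exact congrArg₂ (· ⊓ ·) (hj.extend_comp A) (hj.extend_comp B)
  map_sSup S := by
    rw [hj.extend_eq (τY.iSup_mem fun A : S => (hj.extend A).2), iSup_apply, iSup_subtype']
    ext x
    have hx : ∀ A : τ.opens, (hj.extend A).1 (j x) = A.1 x := fun A =>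
      congrFun (hj.extend_comp A) x
    simp only [Function.comp_apply, iSup_apply, hx, sSup_image, iSup_subtype']
  map_const a := by rw [hj.extend_eq (τY.const_mem a) rfl]

theorem exists_continuous_comp_eq (hj : τ.IsQuasiHomeomorph τY j) (hZ : τZ.IsLSober)
    {f : X → Z} (hf : τ.Continuous τZ f) :
    ∃ g : Y → Z, τY.Continuous τZ g ∧ f = g ∘ j := by
  choose g hg using fun y => hZ.2 ((hj.point y).map hf)
  have hgB : ∀ B : τZ.opens, B.1 ∘ g = (hj.extend ⟨B.1 ∘ f, hf B.1 B.2⟩).1 := fun B =>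
    funext fun y => congrFun (congrArg Point.toFun (hg y)) B
  refine ⟨g, fun B hB => ?_, funext fun x => hZ.isT0 _ _ fun B hB => ?_⟩
  · rw [hgB ⟨B, hB⟩]
    exact Subtype.property _
  · have hBf : (B ∘ g) ∘ j = B ∘ f := by rw [hgB ⟨B, hB⟩, hj.extend_comp]
    exact (congrFun hBf x).symm

theorem isLSobrification (hj : τ.IsQuasiHomeomorph τY j) (hY : τY.IsLSober) :
    IsLSobrification τ τY j where
  sober := hY
  continuous := hj.continuous
  universal Z τZ hZ f hf := by
    obtain ⟨g, hg, rfl⟩ := hj.exists_continuous_comp_eq hZ hf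
    exact ⟨g, ⟨hg, rfl⟩, fun g' hg' => hj.map_ext hZ.isT0 hg'.1 hg hg'.2.symm⟩

end IsQuasiHomeomorph

/-- The two assumptions on `j` are the instances of the universal property at the spectrum of `X`
and at `Y` itself, which make `Y` a retract of the spectrum under `X`. -/
theorem IsLSober.isQuasiHomeomorph (hY : τY.IsLSober) (hj : τ.Continuous τY j)
    (hfac : ∃ g, τY.Continuous τ.spectrum g ∧ g ∘ j = τ.eta)
    (huniq : ∀ g, τY.Continuous τY g → g ∘ j = j → g = id) : τ.IsQuasiHomeomorph τY j := by
  have hη := τ.isQuasiHomeomorph_eta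
  obtain ⟨g, hg, hgj⟩ := hfac
  obtain ⟨k, hk, hkη⟩ := hη.exists_continuous_comp_eq hY hj
  have hkg : k ∘ g = id := huniq _ (hk.comp hg) (by rw [Function.comp_assoc, hgj, ← hkη])
  refine ⟨hj, fun A hA B hB hAB => ?_, fun A hA => ?_⟩
  · have hABk : A ∘ k = B ∘ k := hη.ext _ (hk A hA) _ (hk B hB) (by
      rw [Function.comp_assoc, Function.comp_assoc, ← hkη, hAB])
    calc A = (A ∘ k) ∘ g := by rw [Function.comp_assoc, hkg, Function.comp_id]
      _ = (B ∘ k) ∘ g := by rw [hABk]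
      _ = B := by rw [Function.comp_assoc, hkg, Function.comp_id]
  · obtain ⟨B, hB, rfl⟩ := hη.exists_extension A hA
    exact ⟨B ∘ g, hg B hB, by rw [Function.comp_assoc, hgj]⟩

theorem _root_.IsLSobrification.isQuasiHomeomorph (h : IsLSobrification τ τY j) :
    τ.IsQuasiHomeomorph τY j := by
  refine h.sober.isQuasiHomeomorph h.continuous ?_ fun g hg hgj => ?_
  · obtain ⟨g, ⟨hg, hgj⟩, -⟩ :=
      h.universal _ _ τ.isLSober_spectrum _ τ.isQuasiHomeomorph_eta.continuous
    exact ⟨g, hg, hgj.symm⟩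
  · exact (h.universal _ _ h.sober _ h.continuous).unique ⟨hg, hgj.symm⟩ ⟨τY.continuous_id, rfl⟩

end QuasiHomeomorphisms

section CoreBases

variable {ι : Type u} {b : ι → X} {U : ι → X → L}

/-- A core base: open `L`-subsets `U i` with centres `b i` such that every open `L`-subset `A` is
`⋁ i, A (b i) ∧ U i`. Each `U i` then lies in the core `↑(b i)` of its centre; spaces with a core
base are the `L`-valued analogues of core spaces (also called C-spaces). The index type is kept
apart from the space, so that a core base can be transported along a map that is not injective. -/
structure IsCoreBase (τ : LTopology L X) (b : ι → X) (U : ι → X → L) : Prop where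
  mem_opens : ∀ i, U i ∈ τ.opens
  eq_iSup : ∀ A ∈ τ.opens, ∀ x, A x = ⨆ i, A (b i) ⊓ U i x

theorem IsQuasiHomeomorph.exists_isCoreBase {j : X → Y} (hj : τ.IsQuasiHomeomorph τY j)
    (hU : τ.IsCoreBase b U) : ∃ V, τY.IsCoreBase (j ∘ b) V := by
  let V (i : ι) : τY.opens := hj.extend ⟨U i, hU.mem_opens i⟩
  refine ⟨fun i => V i, fun i => (V i).2, fun B hB y => ?_⟩
  refine congrFun (hj.ext B hB _
    (τY.iSup_const_inf_mem (fun i => B (j (b i))) fun i => (V i).2) (funext fun x => ?_)) y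
  have hV : ∀ i, (V i).1 (j x) = U i x := fun i => congrFun (hj.extend_comp _) x
  simp only [Function.comp_apply, hV]
  exact hU.eq_iSup _ (hj.continuous B hB) x

namespace IsCoreBase

theorem le_specialization_e (hU : τ.IsCoreBase b U) (h : τ.IsT0) (i : ι) (x : X) :
    U i x ≤ (τ.specialization h).e (b i) x := by
  refine (le_specialization_e_iff h).2 fun A hA => ?_
  rw [inf_comm, hU.eq_iSup A hA x]
  exact le_iSup (fun i => A (b i) ⊓ U i x) i

theorem point_eq_iSup (hU : τ.IsCoreBase b U) (p : τ.Point) (A : τ.opens) :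
    p.toFun A = ⨆ i, A.1 (b i) ⊓ p.toFun ⟨U i, hU.mem_opens i⟩ := by
  rw [← p.map_iSup_const_inf]
  exact congrArg p.toFun (Subtype.ext (funext (hU.eq_iSup A.1 A.2)))

theorem isDirected_point (hU : τ.IsCoreBase b U) (h : τ.IsT0) (p : τ.Point) :
    (τ.specialization h).IsDirected
      (zadehImage b fun i => p.toFun ⟨U i, hU.mem_opens i⟩) := by
  refine LOrder.isDirected_zadehImage ?_ fun i k => ?_
  · rw [← p.map_const ⊤, hU.point_eq_iSup p]
    simp only [top_inf_eq]
  · rw [← p.map_inf, hU.point_eq_iSup p]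
    refine iSup_mono fun l => ?_
    calc U i (b l) ⊓ U k (b l) ⊓ p.toFun ⟨U l, hU.mem_opens l⟩
        = p.toFun ⟨U l, hU.mem_opens l⟩ ⊓ U i (b l) ⊓ U k (b l) := by ac_rfl
      _ ≤ _ := inf_le_inf (inf_le_inf_left _ (hU.le_specialization_e h i (b l)))
        (hU.le_specialization_e h k (b l))

theorem isLSober (hU : τ.IsCoreBase b U) (h : τ.IsT0)
    (hlim : ∀ D, (τ.specialization h).IsDirected D → ∃ s, τ.IsLimit D s) : τ.IsLSober := by
  refine ⟨h.eta_injective, fun p => ?_⟩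
  obtain ⟨s, hs⟩ := hlim _ (hU.isDirected_point h p)
  refine ⟨s, Point.ext (funext fun A => ?_)⟩
  rw [hU.point_eq_iSup p A, ← iSup_inf_zadehImage]
  exact hs A.1 A.2

theorem isDirected (hU : τ.IsCoreBase b U) (h : τ.IsT0) (x : X) :
    (τ.specialization h).IsDirected (zadehImage b fun i => U i x) :=
  hU.isDirected_point h (τ.eta x)

theorem isLimit (hU : τ.IsCoreBase b U) (x : X) :
    τ.IsLimit (zadehImage b fun i => U i x) x := fun A hA =>
  (hU.eq_iSup A hA x).trans (iSup_inf_zadehImage ..).symm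

theorem le_wayBelow (hU : τ.IsCoreBase b U) (h : τ.IsLSober) (i : ι) (x : X) :
    U i x ≤ (τ.specialization h.isT0).wayBelow x (b i) := by
  refine LOrder.le_wayBelow_iff.2 fun D s hD hs => ?_
  have hUs := h.isScottOpen (hU.mem_opens i)
  calc U i x ⊓ (τ.specialization h.isT0).e x s ≤ U i s := hUs.upper x s
    _ = ⨆ d, D d ⊓ U i d := by simp only [hUs.sup_eq D s hD hs, inf_comm]
    _ ≤ ⨆ d, D d ⊓ (τ.specialization h.isT0).e (b i) d :=
      iSup_mono fun d => inf_le_inf_left _ (hU.le_specialization_e h.isT0 i d)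

theorem isContinuous_specialization (hU : τ.IsCoreBase b U) (h : τ.IsLSober) :
    (τ.specialization h.isT0).IsContinuous :=
  LOrder.isContinuous_of_le_wayBelow fun x => ⟨_, hU.isDirected h.isT0 x,
    (hU.isLimit x).isSup h.isT0, zadehImage_le_iff.2 fun i => hU.le_wayBelow h i x⟩

theorem scott_specialization (hU : τ.IsCoreBase b U) (h : τ.IsLSober) :
    (τ.specialization h.isT0).scott = τ := by
  refine LTopology.ext (Set.Subset.antisymm (fun A hA => ?_) fun A hA => h.isScottOpen hA)
  have hAU : A = fun x => ⨆ i, A (b i) ⊓ U i x := funext fun x =>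
    (LOrder.IsScottOpen.sup_eq hA _ x (hU.isDirected h.isT0 x)
      ((hU.isLimit x).isSup h.isT0)).trans (iSup_inf_zadehImage ..)
  rw [hAU]
  exact τ.iSup_const_inf_mem _ hU.mem_opens

end IsCoreBase

end CoreBases

end LTopology

namespace LOrder

variable {L P Q : Type u} [Order.Frame L] {o : LOrder L P} {o' : LOrder L Q}

theorem IsSup.isLimit_scott {D : P → L} {s : P} (hs : o.IsSup D s) (hD : o.IsDirected D) :
    o.scott.IsLimit D s := fun _ hA => hA.sup_eq D s hD hs

theorem IsContinuous.isCoreBase_wayBelow (h : o.IsContinuous) :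
    o.scott.IsCoreBase id fun z x => o.wayBelow x z where
  mem_opens := h.isScottOpen_wayBelow
  eq_iSup _ hA x := (h x).2.isLimit_scott (h x).1 _ hA

theorem IsContinuous.isLSober_scott (h : o.IsContinuous) (hd : o.IsDcpo) :
    o.scott.IsLSober := by
  refine h.isCoreBase_wayBelow.isLSober h.isT0_scott fun D hD => ?_
  rw [h.specialization_scott] at hD
  obtain ⟨s, hs⟩ := hd D hD
  exact ⟨s, hs.isLimit_scott hD⟩

theorem ScottContinuous.e_le {f : P → Q} (hf : o.ScottContinuous o' f) (x y : P) :
    o.e x y ≤ o'.e (f x) (f y) :=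
  (le_zadehImage f (o.lower y) x).trans
    ((hf _ y (o.isDirected_lower y) (o.isSup_lower y)).le_e (f x))

theorem ScottContinuous.isDirected_zadehImage {f : P → Q} (hf : o.ScottContinuous o' f)
    {D : P → L} (hD : o.IsDirected D) : o'.IsDirected (zadehImage f D) :=
  LOrder.isDirected_zadehImage hD.nonempty fun x y => (hD.directed x y).trans <|
    iSup_mono fun z => inf_le_inf (inf_le_inf_left _ (hf.e_le x z)) (hf.e_le y z)

theorem ScottContinuous.continuous_scott {f : P → Q} (hf : o.ScottContinuous o' f) :
    o.scott.Continuous o'.scott f := fun B hB =>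
  { upper x y := (inf_le_inf_left _ (hf.e_le x y)).trans (IsScottOpen.upper hB (f x) (f y))
    sup_eq D s hD hs :=
      (IsScottOpen.sup_eq hB _ _ (hf.isDirected_zadehImage hD) (hf D s hD hs)).trans
        (iSup_inf_zadehImage f D B) }

theorem IsContinuous.scottContinuous_iff (h' : o'.IsContinuous) {f : P → Q} :
    o.ScottContinuous o' f ↔ o.scott.Continuous o'.scott f := by
  refine ⟨ScottContinuous.continuous_scott, fun hf D s hD hs => ?_⟩
  rw [← h'.specialization_scott h'.isT0_scott]
  exact (hf.isLimit_zadehImage (hs.isLimit_scott hD)).isSup h'.isT0_scott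

end LOrder

section Completions

variable {L P Y Q : Type u} [Order.Frame L] {oP : LOrder L P} {oQ : LOrder L Q}
  {τ : LTopology L Y}

theorem IsLSobrification.isDirectedCompletion (hP : oP.IsContinuous) {j : P → Y}
    (h : IsLSobrification oP.scott τ j) :
    IsDirectedCompletion oP (τ.specialization h.sober.isT0) j := by
  obtain ⟨V, hV⟩ := h.isQuasiHomeomorph.exists_isCoreBase hP.isCoreBase_wayBelow
  have hc := hV.isContinuous_specialization h.sober
  have hτ := hV.scott_specialization h.sober
  refine ⟨hc, h.sober.isDcpo, ?_, fun M oM hM hMd f hf => ?_⟩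
  · rw [hc.scottContinuous_iff, hτ]
    exact h.continuous
  · simp only [hM.scottContinuous_iff, hτ] at hf ⊢
    simpa only [eq_comm] using h.universal M oM.scott (hM.isLSober_scott hMd) f hf

theorem LOrder.IsContinuous.isDirectedCompletion_eta (hP : oP.IsContinuous) :
    IsDirectedCompletion oP
      (oP.scott.spectrum.specialization oP.scott.isLSober_spectrum.isT0) oP.scott.eta :=
  (oP.scott.isQuasiHomeomorph_eta.isLSobrification
    oP.scott.isLSober_spectrum).isDirectedCompletion hP

theorem LOrder.IsContinuous.scott_specialization_spectrum (hP : oP.IsContinuous) :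
    (oP.scott.spectrum.specialization oP.scott.isLSober_spectrum.isT0).scott =
      oP.scott.spectrum :=
  let ⟨_, hV⟩ := oP.scott.isQuasiHomeomorph_eta.exists_isCoreBase hP.isCoreBase_wayBelow
  hV.scott_specialization oP.scott.isLSober_spectrum

theorem IsDirectedCompletion.isLSobrification (hP : oP.IsContinuous) {j : P → Q}
    (h : IsDirectedCompletion oP oQ j) : IsLSobrification oP.scott oQ.scott j := by
  have hsober := h.isContinuous.isLSober_scott h.isDcpo
  refine (hsober.isQuasiHomeomorph h.scottContinuous.continuous_scott ?_
    fun g hg hgj => ?_).isLSobrification hsober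
  · have hη := hP.isDirectedCompletion_eta
    obtain ⟨g, ⟨hg, hgj⟩, -⟩ := h.universal _ _ hη.isContinuous hη.isDcpo _ hη.scottContinuous
    exact ⟨g, hP.scott_specialization_spectrum ▸ hg.continuous_scott, hgj⟩
  · have hQ := h.isContinuous
    exact (h.universal _ oQ hQ h.isDcpo _ h.scottContinuous).unique
      ⟨hQ.scottContinuous_iff.2 hg, hgj⟩
      ⟨hQ.scottContinuous_iff.2 oQ.scott.continuous_id, rfl⟩

end Completions

theorem mainTheorem4 {L P Q : Type u} [Order.Frame L]
    (oP : LOrder L P) (oQ : LOrder L Q) (hP : oP.IsContinuous) (hQ : oQ.IsContinuous) :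
    (∀ (Y : Type u) (τ : LTopology L Y) (j : P → Y) (h : IsLSobrification oP.scott τ j),
      IsDirectedCompletion oP (τ.specialization h.sober.isT0) j) ∧
    (∀ j : P → Q, IsDirectedCompletion oP oQ j → IsLSobrification oP.scott oQ.scott j) ∧
    (∀ j : P → Q, IsDirectedCompletion oP oQ j ↔ IsLSobrification oP.scott oQ.scott j) := by
  refine ⟨fun Y τ j h => h.isDirectedCompletion hP, fun j h => h.isLSobrification hP,
    fun j => ⟨fun h => h.isLSobrification hP, fun h => ?_⟩⟩
  simpa only [hQ.specialization_scott] using h.isDirectedCompletion hP
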